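/- All graphs are finite and simple. A block of a graph $G$ is a maximal 2-connected subgraph of $G$ (2-connected: connected, at least three vertices, and connected after deletion of any one vertex) or a bridge together with its two end vertices. Let $G$ be a connected graph, let $\mathcal B$ be its set of blocks, and let $$\mathrm{CBP}(G)=\mathrm{conv}\{\chi^{\mathcal A} : \mathcal A\subseteq\mathcal B,\ G[\mathcal A]:=\textstyle\bigcup_{B\in\mathcal A}B \text{ is connected}\}\subseteq\mathbb R^{\mathcal B}$$ be its connected blocks polytope, where $\chi^{\mathcal A}$ is the $0/1$ incidence vector of $\mathcal A$ and the empty graph counts as connected. Put $d=\dim \mathrm{CBP}(G)$ and let $h^*_i$ be the coefficients of the $h^*$-polynomial of $\mathrm{CBP}(G)$, i.e. $\sum_{n\ge 0}|n\,\mathrm{CBP}(G)\cap\mathbb Z^{\mathcal B}|\,t^n=\frac{\sum_i h^*_i t^i}{(1-t)^{d+1}}$. **Theorem.** One has $$h^*_1=|\mathrm{CBP}(G)\cap\mathbb Z^{\mathcal B}|-(d+1)\qquad\text{and}\qquad h_1^*\ge \dim\mathrm{CBP}(G)-1 .$$ If $G$ has at least two vertices, then $h_1^*=\dim\mathrm{CBP}(G)-1$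 if and only if $|\mathcal B|\le 2$. Moreover, let $G$ have at least two vertices and let $(\gamma_0,\dots,\gamma_{\lfloor (d-1)/2\rfloor})$ be the $\gamma$-vector of the $h^*$-vector with respect to the center of symmetry $(d-1)/2$, i.e. the vector determined by $h^*_k=\sum_{i=0}^{k}\gamma_i\binom{d-1-2i}{k-i}$ for $0\le k\le (d-1)/2$ (for a symmetric $h^*$-vector, $h^*_k=h^*_{d-1-k}$, this says $\sum_k h^*_kt^k=\sum_i\gamma_i\,t^i(1+t)^{d-1-2i}$), with $\gamma_k=0$ for $k>(d-1)/2$. Then $\gamma_1\ge 0$, with $\gamma_1=0$ if and only if $|\mathcal B|\le 2$. -/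

import Mathlib

open scoped Pointwise

namespace ConnectedBlocks

/-- A subgraph `H` is 2-connected: it is connected, has at least three vertices, and stays connected
when any one of its vertices is deleted. -/
def IsTwoConnected {V : Type*} {G : SimpleGraph V} (H : G.Subgraph) : Prop :=
  H.Connected ∧ 3 ≤ H.verts.ncard ∧ ∀ v ∈ H.verts, (H.deleteVerts {v}).Connected

/-- The set of blocks of `G`: the maximal 2-connected subgraphs, and the bridges
together with their two end vertices. -/
def blocks {V : Type*} (G : SimpleGraph V) : Set G.Subgraph :=
  {H | Maximal IsTwoConnected H ∨
    ∃ (u v : V) (huv : G.Adj u v), G.IsBridge s(u, v) ∧ H = G.subgraphOfAdj huv}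

/-- The subgraph `G[A]` induced by a set `A` of blocks, i.e. the union of the blocks in `A`. -/
def blockUnion {V : Type*} {G : SimpleGraph V} (A : Set (blocks G)) : G.Subgraph :=
  ⨆ B ∈ A, (B : G.Subgraph)

open Classical in
/-- The incidence vector of a set `A` of blocks. -/
noncomputable def incidenceVector {V : Type*} {G : SimpleGraph V} (A : Set (blocks G)) :
    blocks G → ℝ :=
  fun B => if B ∈ A then 1 else 0

/-- The connected blocks polytope of `G`. (`Preconnected` is used since the empty graph counts as
connected; for a nonempty graph it is the same as being connected.) -/
def CBP {V : Type*} (G : SimpleGraph V) : Set (blocks G → ℝ) :=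
  convexHull ℝ {x | ∃ A : Set (blocks G), (blockUnion A).Preconnected ∧ x = incidenceVector A}

/-- The dimension of a (nonempty) polytope: the dimension of its affine hull. -/
noncomputable def polytopeDim {ι : Type*} (P : Set (ι → ℝ)) : ℕ :=
  Module.finrank ℝ (affineSpan ℝ P).direction

/-- The number of lattice points in the `n`-th dilation of `P`. -/
noncomputable def latticeCount {ι : Type*} (P : Set (ι → ℝ)) (n : ℕ) : ℕ :=
  {z : ι → ℤ | (fun i => (z i : ℝ)) ∈ (n : ℝ) • P}.ncard

/-- The coefficients of the `h^*`-polynomial of a lattice polytope `P` of dimension `d`, which is the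
numerator of the Ehrhart series: `∑ E(P,n) t^n = h^*(t) / (1 - t)^(d+1)`. -/
noncomputable def hStar {ι : Type*} (P : Set (ι → ℝ)) (i : ℕ) : ℤ :=
  PowerSeries.coeff i
    (PowerSeries.mk (fun n => (latticeCount P n : ℤ)) * (1 - PowerSeries.X) ^ (polytopeDim P + 1))

/-- `hStar` is the coefficient vector of the lattice point counting function in the basis
`binom (n + d - i) d`, `0 ≤ i ≤ d`. -/
theorem hStar_eq_of_binomial {ι : Type*} (P : Set (ι → ℝ)) (a : ℕ → ℤ)
    (ha : ∀ n : ℕ, (latticeCount P n : ℤ) = ∑ i ∈ Finset.range (polytopeDim P + 1),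
      a i * ((n + polytopeDim P - i).choose (polytopeDim P) : ℤ)) (k : ℕ) :
    hStar P k = if k ≤ polytopeDim P then a k else 0 := by
  have key : PowerSeries.mk (fun n => (latticeCount P n : ℤ)) =
      (∑ i ∈ Finset.range (polytopeDim P + 1), PowerSeries.C (a i) * PowerSeries.X ^ i) *
        PowerSeries.mk (fun n => ((polytopeDim P + n).choose (polytopeDim P) : ℤ)) := by
    ext n
    rw [PowerSeries.coeff_mk, ha, Finset.sum_mul, map_sum]
    refine Finset.sum_congr rfl fun i hi => ?_
    rw [mul_assoc, PowerSeries.coeff_C_mul, PowerSeries.coeff_X_pow_mul']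
    have hi' := Finset.mem_range.1 hi
    split_ifs with h
    · rw [PowerSeries.coeff_mk, show n + polytopeDim P - i = polytopeDim P + (n - i) by omega]
    · rw [Nat.choose_eq_zero_of_lt (by omega)]; simp
  unfold hStar
  rw [key, mul_assoc, PowerSeries.mk_add_choose_mul_one_sub_pow_eq_one, mul_one, map_sum]
  simp only [PowerSeries.coeff_C_mul, PowerSeries.coeff_X_pow]
  simp

/-- The `γ`-vector of a vector `(h_0, …, h_s)` that is symmetric (`h_k = h_{s-k}`): the coefficients
of `∑ h_k t^k` in the basis `t^i (1 + t)^(s - 2 i)`, `0 ≤ i ≤ s / 2`. The change of basis is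
triangular, so `γ_k` is found by comparing the coefficients of `t^k`; see `gammaVector_spec` and
`gammaVector_unique`. There is no `γ_k` for `k > s / 2`, where the value is `0`. -/
def gammaVector (h : ℕ → ℤ) (s : ℕ) (k : ℕ) : ℤ :=
  if k ≤ s / 2 then
    h k - ∑ i : Fin k, gammaVector h s i * ((s - 2 * i).choose (k - i) : ℤ)
  else 0

theorem coeff_gammaBasis (s i k : ℕ) :
    (Polynomial.X ^ i * (1 + Polynomial.X) ^ (s - 2 * i) : Polynomial ℤ).coeff k =
      if i ≤ k then ((s - 2 * i).choose (k - i) : ℤ) else 0 := by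
  rw [Polynomial.coeff_X_pow_mul']
  simp [Polynomial.coeff_one_add_X_pow]

theorem sum_gammaBasis_coeff (g : ℕ → ℤ) (s k : ℕ) (hk : k ≤ s / 2) :
    (∑ i ∈ Finset.range (s / 2 + 1), Polynomial.C (g i) *
      (Polynomial.X ^ i * (1 + Polynomial.X) ^ (s - 2 * i)) : Polynomial ℤ).coeff k =
      g k + ∑ i : Fin k, g i * ((s - 2 * i).choose (k - i) : ℤ) := by
  rw [Polynomial.finsetSum_coeff]
  simp only [Polynomial.coeff_C_mul, coeff_gammaBasis]
  rw [Fin.sum_univ_eq_sum_range (fun i => g i * ((s - 2 * i).choose (k - i) : ℤ)) k,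
    ← Finset.sum_subset (Finset.range_mono (show k + 1 ≤ s / 2 + 1 by omega)),
    Finset.sum_range_succ, add_comm]
  · congr 1
    · simp
    · refine Finset.sum_congr rfl fun i hi => ?_
      rw [if_pos (Finset.mem_range.1 hi).le]
  · intro i _ hi
    rw [if_neg (by simpa using hi)]; simp

/-- If `h` is symmetric, its `γ`-vector expresses it in the basis `t^i (1 + t)^(s - 2 i)`. -/
theorem gammaVector_spec (h : ℕ → ℤ) (s : ℕ) (hs : ∀ k ≤ s, h (s - k) = h k) :
    (∑ k ∈ Finset.range (s + 1), Polynomial.C (h k) * Polynomial.X ^ k : Polynomial ℤ) =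
      ∑ i ∈ Finset.range (s / 2 + 1), Polynomial.C (gammaVector h s i) *
        (Polynomial.X ^ i * (1 + Polynomial.X) ^ (s - 2 * i)) := by
  have low : ∀ k ≤ s / 2, h k = (∑ i ∈ Finset.range (s / 2 + 1),
      Polynomial.C (gammaVector h s i) *
        (Polynomial.X ^ i * (1 + Polynomial.X) ^ (s - 2 * i)) : Polynomial ℤ).coeff k := by
    intro k hk
    rw [sum_gammaBasis_coeff _ _ _ hk]
    conv_rhs => rw [gammaVector, if_pos hk]
    ring
  ext k
  have hl : (∑ k ∈ Finset.range (s + 1), Polynomial.C (h k) * Polynomial.X ^ k :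
      Polynomial ℤ).coeff k = if k ≤ s then h k else 0 := by
    simp [Polynomial.coeff_X_pow]
  rw [hl]
  by_cases hk : k ≤ s / 2
  · rw [if_pos (by omega), low k hk]
  · split_ifs with hks
    · rw [← hs k hks, low (s - k) (by omega), Polynomial.finsetSum_coeff,
        Polynomial.finsetSum_coeff]
      refine Finset.sum_congr rfl fun i hi => ?_
      have hi' := Finset.mem_range.1 hi
      rw [Polynomial.coeff_C_mul, Polynomial.coeff_C_mul, coeff_gammaBasis, coeff_gammaBasis]
      congr 1
      rw [if_pos (show i ≤ k by omega)]
      split_ifs with h1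
      · rw [← Nat.choose_symm (show k - i ≤ s - 2 * i by omega)]
        congr 2
        omega
      · rw [Nat.choose_eq_zero_of_lt (by omega)]; simp
    · rw [Polynomial.finsetSum_coeff]
      refine (Finset.sum_eq_zero fun i hi => ?_).symm
      have hi' := Finset.mem_range.1 hi
      rw [Polynomial.coeff_C_mul, coeff_gammaBasis, if_pos (by omega),
        Nat.choose_eq_zero_of_lt (by omega)]
      simp

/-- The `γ`-vector is the only coefficient vector in that basis. -/
theorem gammaVector_unique (h g : ℕ → ℤ) (s : ℕ)
    (hg : (∑ k ∈ Finset.range (s + 1), Polynomial.C (h k) * Polynomial.X ^ k : Polynomial ℤ) =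
      ∑ i ∈ Finset.range (s / 2 + 1), Polynomial.C (g i) *
        (Polynomial.X ^ i * (1 + Polynomial.X) ^ (s - 2 * i))) :
    ∀ k ≤ s / 2, gammaVector h s k = g k := by
  intro k
  induction k using Nat.strong_induction_on with
  | _ k ih =>
    intro hk
    have h1 := congrArg (fun p => Polynomial.coeff p k) hg
    simp only [sum_gammaBasis_coeff _ _ _ hk] at h1
    have hl : (∑ k ∈ Finset.range (s + 1), Polynomial.C (h k) * Polynomial.X ^ k :
        Polynomial ℤ).coeff k = h k := by
      simp [Polynomial.coeff_X_pow]
      omega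
    rw [hl] at h1
    rw [gammaVector, if_pos hk, h1]
    have : ∑ i : Fin k, gammaVector h s i * ((s - 2 * i).choose (k - i) : ℤ) =
        ∑ i : Fin k, g i * ((s - 2 * i).choose (k - i) : ℤ) :=
      Finset.sum_congr rfl fun i _ => by rw [ih i i.2 (by omega)]
    rw [this]; ring

/-- The `γ`-vector of the `h^*`-vector of `P`, for a lattice polytope `P` of dimension `d` whose
`h^*`-vector is symmetric with center `(d - 1) / 2`, i.e. `h^*_i = h^*_{d - 1 - i}`. -/
noncomputable def gammaStar {ι : Type*} (P : Set (ι → ℝ)) (i : ℕ) : ℤ :=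
  gammaVector (hStar P) (polytopeDim P - 1) i

end ConnectedBlocks

namespace ConnectedBlocks

open SimpleGraph

variable {V : Type*} {G : SimpleGraph V}

/-- Deleting a vertex from a cycle leaves a path, so a cycle is 2-connected. -/
theorem isTwoConnected_toSubgraph_of_isCycle [Finite V] {u : V} {c : G.Walk u u}
    (hc : c.IsCycle) : IsTwoConnected c.toSubgraph := by
  classical
  refine ⟨c.toSubgraph_connected, ?_, ?_⟩
  · have h1 : ((c.support.tail.toFinset : Finset V) : Set V) ⊆ c.toSubgraph.verts := by
      intro v hv
      rw [Walk.mem_verts_toSubgraph]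
      exact List.mem_of_mem_tail (by simpa using hv)
    have h2 := Set.ncard_le_ncard h1 (Set.toFinite _)
    rw [Set.ncard_coe_finset, List.toFinset_card_of_nodup hc.support_nodup] at h2
    have h3 := hc.three_le_length
    simp only [List.length_tail, Walk.length_support] at h2
    omega
  · intro w hw
    rw [Walk.mem_verts_toSubgraph] at hw
    rw [← Walk.toSubgraph_rotate c hw]
    have hr := hc.rotate hw
    generalize c.rotate w hw = d at hr
    cases d with
    | nil => exact absurd hr Walk.not_isCycle_nil
    | cons h q =>
      rename_i x
      have hq := ((Walk.cons_isCycle_iff _ _).1 hr).1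
      rw [Walk.toSubgraph, ← Walk.toSubgraph_reverse]
      have hq' := hq.reverse
      generalize q.reverse = r at hq'
      cases r with
      | nil => exact absurd rfl h.ne
      | cons h' r =>
        have hw := ((Walk.cons_isPath_iff _ _).1 hq').2
        refine r.toSubgraph_connected.mono' ?_ ?_
        · intro a b hab
          have ha : a ≠ w := by
            rintro rfl
            exact hw ((Walk.mem_verts_toSubgraph _).1 hab.fst_mem)
          have hb : b ≠ w := by
            rintro rfl
            exact hw ((Walk.mem_verts_toSubgraph _).1 hab.snd_mem)
          have h1 := hab.fst_mem
          have h2 := hab.snd_mem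
          simp only [Walk.mem_verts_toSubgraph] at h1 h2
          simp [Walk.toSubgraph, ha, hb, hab, h1, h2]
        · ext a
          have h1 := r.start_mem_support
          have h2 := r.end_mem_support
          by_cases ha : a = w
          · subst ha
            simp [hw]
          · simp only [Walk.mem_verts_toSubgraph, Subgraph.deleteVerts_verts, Walk.toSubgraph,
              Subgraph.verts_sup, subgraphOfAdj_verts, Set.mem_sdiff, Set.mem_union,
              Set.mem_insert_iff, Set.mem_singleton_iff, ha, false_or, not_false_eq_true, and_true]
            constructor
            · tauto
            · rintro (rfl | rfl | h) <;> assumption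

/-- Every edge lies in a block. -/
theorem exists_block_adj [Finite V] {u v : V} (h : G.Adj u v) :
    ∃ B : blocks G, (B : G.Subgraph).Adj u v := by
  by_cases hb : G.IsBridge s(u, v)
  · exact ⟨⟨_, Or.inr ⟨u, v, h, hb, rfl⟩⟩, by simp⟩
  · rw [isBridge_iff_forall_cycle_notMem h] at hb
    push Not at hb
    obtain ⟨w, c, hc, hm⟩ := hb
    obtain ⟨M, hle, hM⟩ := (Set.toFinite {H : G.Subgraph | IsTwoConnected H}).exists_le_maximal
      (isTwoConnected_toSubgraph_of_isCycle hc)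
    refine ⟨⟨M, Or.inl hM⟩, hle.2 ?_⟩
    rwa [← Subgraph.mem_edgeSet, Walk.mem_edges_toSubgraph]

theorem block_connected (B : blocks G) : (B : G.Subgraph).Connected := by
  rcases B.2 with h | ⟨u, v, huv, -, h⟩
  · exact h.1.1
  · rw [h]
    exact Subgraph.subgraphOfAdj_connected huv

theorem exists_block_mem [Finite V] [Nontrivial V] (hG : G.Connected) (v : V) :
    ∃ B : blocks G, v ∈ (B : G.Subgraph).verts := by
  obtain ⟨w, hw⟩ := hG.preconnected.exists_adj_of_nontrivial v
  obtain ⟨B, hB⟩ := exists_block_adj hw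
  exact ⟨B, hB.fst_mem⟩

theorem blockUnion_empty : (blockUnion (∅ : Set (blocks G))).Preconnected := by
  refine ⟨fun u => ?_⟩
  have := u.2
  simp [blockUnion] at this

theorem blockUnion_singleton (B : blocks G) : (blockUnion {B}).Preconnected := by
  simpa [blockUnion] using (block_connected B).preconnected

theorem blockUnion_univ [Finite V] [Nontrivial V] (hG : G.Connected) :
    (blockUnion (Set.univ : Set (blocks G))).Preconnected := by
  have : blockUnion (Set.univ : Set (blocks G)) = ⊤ := by
    refine top_le_iff.1 ⟨fun v _ => ?_, fun u v h => ?_⟩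
    · obtain ⟨B, hB⟩ := exists_block_mem hG v
      simpa [blockUnion] using ⟨B.1, B.2, hB⟩
    · obtain ⟨B, hB⟩ := exists_block_adj h
      simpa [blockUnion] using ⟨B.1, B.2, hB⟩
  rw [this]
  exact ⟨Subgraph.topIso.connected_iff.2 hG |>.preconnected⟩

/-- The graph on the blocks of `G` in which two blocks are adjacent if they share a vertex. -/
def blockIntersectionGraph (G : SimpleGraph V) : SimpleGraph (blocks G) where
  Adj B C := B ≠ C ∧ ((B : G.Subgraph) ⊓ C).verts.Nonempty
  symm := ⟨fun B C h => ⟨h.1.symm, by rw [inf_comm]; exact h.2⟩⟩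
  loopless := ⟨fun B h => h.1 rfl⟩

theorem blockUnion_pair {B C : blocks G} (h : (blockIntersectionGraph G).Adj B C) :
    (blockUnion {B, C}).Preconnected := by
  have := Subgraph.connected_sup (block_connected B).preconnected (block_connected C).preconnected h.2
  rw [blockUnion, iSup_pair]
  exact this.preconnected

theorem blockIntersectionGraph_reachable_of_mem {v : V} {B C : blocks G}
    (hB : v ∈ (B : G.Subgraph).verts) (hC : v ∈ (C : G.Subgraph).verts) :
    (blockIntersectionGraph G).Reachable B C := by
  by_cases h : B = C
  · rw [h]
  · exact Adj.reachable ⟨h, v, hB, hC⟩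

theorem blockIntersectionGraph_reachable_of_walk [Finite V] {v w : V} (p : G.Walk v w)
    {B C : blocks G} (hB : v ∈ (B : G.Subgraph).verts) (hC : w ∈ (C : G.Subgraph).verts) :
    (blockIntersectionGraph G).Reachable B C := by
  induction p generalizing B with
  | nil => exact blockIntersectionGraph_reachable_of_mem hB hC
  | cons h p ih =>
    obtain ⟨D, hD⟩ := exists_block_adj h
    exact (blockIntersectionGraph_reachable_of_mem hB hD.fst_mem).trans (ih hD.snd_mem hC)

theorem blockIntersectionGraph_preconnected [Finite V] (hG : G.Connected) :
    (blockIntersectionGraph G).Preconnected := by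
  intro B C
  obtain ⟨v, hv⟩ := (block_connected B).nonempty
  obtain ⟨w, hw⟩ := (block_connected C).nonempty
  obtain ⟨p⟩ := hG.preconnected v w
  exact blockIntersectionGraph_reachable_of_walk p hv hw

/-- The sets of blocks whose union is connected. -/
def connectedBlockSets (G : SimpleGraph V) : Set (Set (blocks G)) :=
  {A | (blockUnion A).Preconnected}

theorem card_edgeSet_blockIntersectionGraph [Finite V] (hG : G.Connected) :
    (blocks G).ncard ≤ Nat.card (blockIntersectionGraph G).edgeSet + 1 := by
  rw [← Nat.card_coe_set_eq]
  rcases isEmpty_or_nonempty (blocks G) with h | h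
  · simp
  · exact (Connected.mk (blockIntersectionGraph_preconnected hG)).card_vert_le_card_edgeSet_add_one

theorem ncard_of_mem_edgeSet {e : Sym2 (blocks G)} (he : e ∈ (blockIntersectionGraph G).edgeSet) :
    (e : Set (blocks G)).ncard = 2 ∧ (e : Set (blocks G)) ∈ connectedBlockSets G := by
  induction e with
  | _ B C =>
    have : ((s(B, C) : Sym2 (blocks G)) : Set (blocks G)) = {B, C} := by ext; simp
    rw [this]
    exact ⟨Set.ncard_pair (Adj.ne ((mem_edgeSet _).1 he)), blockUnion_pair ((mem_edgeSet _).1 he)⟩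

/-- The empty set, the singletons, the pairs of blocks sharing a vertex: at least `2 |𝓑|` connected
sets of blocks with at most two elements. -/
theorem two_mul_ncard_blocks_le_small [Finite V] (hG : G.Connected) :
    2 * (blocks G).ncard ≤ {A ∈ connectedBlockSets G | A.ncard ≤ 2}.ncard := by
  let f : Option (blocks G) ⊕ (blockIntersectionGraph G).edgeSet →
      {A ∈ connectedBlockSets G | A.ncard ≤ 2} := Sum.elim
    (fun o => o.elim ⟨∅, blockUnion_empty, by simp⟩
      fun B => ⟨{B}, blockUnion_singleton B, by simp⟩)
    (fun e => ⟨(e : Sym2 (blocks G)), (ncard_of_mem_edgeSet e.2).2, (ncard_of_mem_edgeSet e.2).1.le⟩)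
  have hf : Function.Injective f := by
    refine Function.Injective.sumElim ?_ ?_ ?_
    · rintro (_ | B) (_ | C) h <;> simp_all
    · intro e e' h
      exact Subtype.ext (SetLike.coe_injective (Subtype.ext_iff.1 h))
    · rintro (_ | B) e h
      all_goals
        have h1 := congrArg Set.ncard (Subtype.ext_iff.1 h)
        simp [(ncard_of_mem_edgeSet e.2).1] at h1
  have h1 := Nat.card_le_card_of_injective f hf
  have h2 := card_edgeSet_blockIntersectionGraph hG
  rw [Nat.card_sum, Finite.card_option, Nat.card_coe_set_eq (blocks G), Nat.card_coe_set_eq {A | _}] at h1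
  omega

theorem two_mul_ncard_blocks_le [Finite V] (hG : G.Connected) :
    2 * (blocks G).ncard ≤ (connectedBlockSets G).ncard :=
  (two_mul_ncard_blocks_le_small hG).trans
    (Set.ncard_le_ncard (Set.sep_subset _ _) (Set.toFinite _))

theorem two_mul_ncard_blocks_eq_iff [Finite V] [Nontrivial V] (hG : G.Connected) :
    (connectedBlockSets G).ncard = 2 * (blocks G).ncard ↔ (blocks G).ncard ≤ 2 := by
  constructor
  · intro h
    by_contra! h3
    have : {A ∈ connectedBlockSets G | A.ncard ≤ 2} ⊂ connectedBlockSets G := by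
      refine (Set.ssubset_iff_of_subset (Set.sep_subset _ _)).2
        ⟨Set.univ, blockUnion_univ hG, fun h => ?_⟩
      have := h.2
      rw [Set.ncard_univ, Nat.card_coe_set_eq] at this
      omega
    have h1 := Set.ncard_lt_ncard this (Set.toFinite _)
    have h2 := two_mul_ncard_blocks_le_small hG
    omega
  · intro h
    have h1 : (connectedBlockSets G).ncard ≤ 2 ^ (blocks G).ncard := by
      rw [← Nat.card_coe_set_eq (blocks G), ← Set.ncard_univ, ← Set.ncard_powerset Set.univ]
      exact Set.ncard_le_ncard (fun A _ => Set.subset_univ A) (Set.toFinite _)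
    have h2 := two_mul_ncard_blocks_le hG
    obtain ⟨v⟩ := hG.nonempty
    obtain ⟨B, -⟩ := exists_block_mem hG v
    have h0 : 0 < (blocks G).ncard := (Set.ncard_pos (Set.toFinite _)).2 ⟨B.1, B.2⟩
    interval_cases (blocks G).ncard <;> omega

end ConnectedBlocks

namespace ConnectedBlocks

section Ehrhart

variable {ι : Type*} {P : Set (ι → ℝ)}

theorem latticeCount_zero (hP : P.Nonempty) : latticeCount P 0 = 1 := by
  have : {z : ι → ℤ | (fun i => (z i : ℝ)) ∈ ((0 : ℕ) : ℝ) • P} = {0} := by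
    ext z
    rw [Set.mem_ofPred_eq, Nat.cast_zero, Set.zero_smul_set hP, Set.mem_zero,
      Set.mem_singleton_iff, funext_iff, funext_iff]
    simp
  rw [latticeCount, this, Set.ncard_singleton]

theorem latticeCount_one : latticeCount P 1 = {z : ι → ℤ | (fun i => (z i : ℝ)) ∈ P}.ncard := by
  simp [latticeCount]

theorem hStar_zero (hP : P.Nonempty) : hStar P 0 = 1 := by
  simp [hStar, latticeCount_zero hP]

theorem hStar_one (hP : P.Nonempty) :
    hStar P 1 = ({z : ι → ℤ | (fun i => (z i : ℝ)) ∈ P}.ncard : ℤ) - (polytopeDim P + 1) := by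
  have h0 : PowerSeries.coeff 0 ((1 - PowerSeries.X : PowerSeries ℤ) ^ (polytopeDim P + 1)) = 1 := by
    simp
  have h1 : PowerSeries.coeff 1 ((1 - PowerSeries.X : PowerSeries ℤ) ^ (polytopeDim P + 1)) =
      -(polytopeDim P + 1) := by
    rw [PowerSeries.coeff_one_pow]
    simp [PowerSeries.coeff_one]
  rw [hStar, PowerSeries.coeff_mul, Finset.Nat.antidiagonal_succ]
  simp only [Finset.Nat.antidiagonal_zero, Finset.map_singleton, Finset.sum_cons,
    Finset.sum_singleton, PowerSeries.coeff_mk, Function.Embedding.prodMap,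
    Function.Embedding.coeFn_mk, Prod.map, Function.Embedding.refl_apply, zero_add, h0, h1,
    latticeCount_zero hP, Nat.succ_eq_add_one, latticeCount_one]
  push_cast
  ring

theorem gammaVector_zero (h : ℕ → ℤ) (s : ℕ) : gammaVector h s 0 = h 0 := by
  rw [gammaVector]
  simp

theorem gammaVector_one (h : ℕ → ℤ) (s : ℕ) :
    gammaVector h s 1 = if 2 ≤ s then h 1 - h 0 * s else 0 := by
  rw [gammaVector]
  simp [gammaVector_zero, Nat.le_div_iff_mul_le]

/-- A polytope that contains the origin and the standard unit vectors is full-dimensional. -/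
theorem polytopeDim_eq_card [Finite ι] [DecidableEq ι] (h0 : 0 ∈ P)
    (h1 : ∀ i, Pi.single i (1 : ℝ) ∈ P) : polytopeDim P = Nat.card ι := by
  have := Fintype.ofFinite ι
  have : (affineSpan ℝ P).direction = ⊤ := by
    rw [direction_affineSpan, eq_top_iff, ← (Pi.basisFun ℝ ι).span_eq, Submodule.span_le]
    rintro _ ⟨i, rfl⟩
    simpa using vsub_mem_vectorSpan ℝ (h1 i) h0
  rw [polytopeDim, this, finrank_top, Module.finrank_fintype_fun_eq_card, Nat.card_eq_fintype_card]

/-- The points with all coordinates in `{0, 1}` are extreme points of the unit cube. -/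
theorem mem_extremePoints_cube {x : ι → ℝ} (hx : ∀ i, x i = 0 ∨ x i = 1) :
    x ∈ (Set.univ.pi fun _ : ι => Set.Icc (0 : ℝ) 1).extremePoints ℝ := by
  rw [extremePoints_pi]
  intro i _
  rw [mem_extremePoints_iff_left]
  rcases hx i with h | h <;> rw [h]
  · refine ⟨by simp, ?_⟩
    rintro a ⟨ha, -⟩ b ⟨hb, -⟩ ⟨s, t, hs, ht, -, hst⟩
    simp only [smul_eq_mul] at hst
    nlinarith [mul_nonneg ht.le hb]
  · refine ⟨by simp, ?_⟩
    rintro a ⟨-, ha⟩ b ⟨-, hb⟩ ⟨s, t, hs, ht, h1, hst⟩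
    simp only [smul_eq_mul] at hst
    nlinarith [mul_nonneg ht.le (sub_nonneg.2 hb)]

/-- The lattice points of a `0/1` polytope are its defining points. -/
theorem intCast_mem_convexHull_iff {S : Set (ι → ℝ)} (hS : ∀ x ∈ S, ∀ i, x i = 0 ∨ x i = 1)
    (z : ι → ℤ) : (fun i => (z i : ℝ)) ∈ convexHull ℝ S ↔ (fun i => (z i : ℝ)) ∈ S := by
  refine ⟨fun hz => ?_, fun hz => subset_convexHull ℝ S hz⟩
  have hsub : convexHull ℝ S ⊆ Set.univ.pi fun _ : ι => Set.Icc (0 : ℝ) 1 := by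
    refine convexHull_min (fun x hx i _ => ?_) (convex_pi fun _ _ => convex_Icc 0 1)
    rcases hS x hx i with h | h <;> simp [h]
  refine extremePoints_convexHull_subset (𝕜 := ℝ)
    (inter_extremePoints_subset_extremePoints_of_subset hsub
      ⟨hz, mem_extremePoints_cube fun i => ?_⟩)
  obtain ⟨h0, h1⟩ := hsub hz i trivial
  have h0' : 0 ≤ z i := Int.cast_nonneg_iff.1 h0
  have h1' : z i ≤ 1 := by
    have h2 : (z i : ℝ) ≤ 1 := h1
    exact_mod_cast h2
  have : z i = 0 ∨ z i = 1 := by omega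
  exact_mod_cast this

end Ehrhart

variable {V : Type*} {G : SimpleGraph V}

theorem incidenceVector_mem_CBP {A : Set (blocks G)} (hA : A ∈ connectedBlockSets G) :
    incidenceVector A ∈ CBP G :=
  subset_convexHull ℝ _ ⟨A, hA, rfl⟩

theorem incidenceVector_empty : incidenceVector (∅ : Set (blocks G)) = 0 := by
  ext B
  simp [incidenceVector]

theorem zero_mem_CBP : (0 : blocks G → ℝ) ∈ CBP G :=
  incidenceVector_empty (G := G) ▸ incidenceVector_mem_CBP blockUnion_empty

theorem polytopeDim_CBP [Finite V] : polytopeDim (CBP G) = (blocks G).ncard := by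
  classical
  rw [polytopeDim_eq_card zero_mem_CBP fun B => ?_, Nat.card_coe_set_eq]
  convert incidenceVector_mem_CBP (blockUnion_singleton B)
  ext C
  simp [incidenceVector, Pi.single_apply]

/-- The lattice points of the connected blocks polytope are in bijection with the connected sets of
blocks. -/
theorem ncard_latticePoints_CBP :
    {z : blocks G → ℤ | (fun B => (z B : ℝ)) ∈ CBP G}.ncard = (connectedBlockSets G).ncard := by
  classical
  have hinj : Function.Injective fun (A : Set (blocks G)) (B : blocks G) =>
      if B ∈ A then (1 : ℤ) else 0 := by
    intro A A' h
    ext B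
    have := congrFun h B
    by_cases h1 : B ∈ A <;> by_cases h2 : B ∈ A' <;> simp_all
  rw [← Set.ncard_image_of_injective _ hinj]
  congr 1
  ext z
  rw [Set.mem_ofPred_eq, CBP, intCast_mem_convexHull_iff]
  · refine exists_congr fun A => and_congr Iff.rfl ?_
    rw [funext_iff, funext_iff]
    refine forall_congr' fun B => ?_
    by_cases h : B ∈ A <;> simp [incidenceVector, h, eq_comm]
  · rintro _ ⟨A, -, rfl⟩ B
    by_cases h : B ∈ A <;> simp [incidenceVector, h]

end ConnectedBlocks

theorem mainTheorem10 {V : Type*} [Finite V] (G : SimpleGraph V) (hG : G.Connected) :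
    (ConnectedBlocks.polytopeDim (ConnectedBlocks.CBP G) : ℤ) - 1 ≤
        ConnectedBlocks.hStar (ConnectedBlocks.CBP G) 1 ∧
      ConnectedBlocks.hStar (ConnectedBlocks.CBP G) 1 =
        ({z : ConnectedBlocks.blocks G → ℤ |
            (fun B => (z B : ℝ)) ∈ ConnectedBlocks.CBP G}.ncard : ℤ) -
          (ConnectedBlocks.polytopeDim (ConnectedBlocks.CBP G) + 1) ∧
      (Nontrivial V →
        (ConnectedBlocks.hStar (ConnectedBlocks.CBP G) 1 =
            (ConnectedBlocks.polytopeDim (ConnectedBlocks.CBP G) : ℤ) - 1 ↔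
          (ConnectedBlocks.blocks G).ncard ≤ 2) ∧
        0 ≤ ConnectedBlocks.gammaStar (ConnectedBlocks.CBP G) 1 ∧
        (ConnectedBlocks.gammaStar (ConnectedBlocks.CBP G) 1 = 0 ↔
          (ConnectedBlocks.blocks G).ncard ≤ 2)) := by
  have hne : (ConnectedBlocks.CBP G).Nonempty := ⟨0, ConnectedBlocks.zero_mem_CBP⟩
  have h1 := ConnectedBlocks.hStar_one hne
  have h2 := ConnectedBlocks.two_mul_ncard_blocks_le hG
  refine ⟨?_, h1, fun hV => ?_⟩
  · rw [h1, ConnectedBlocks.ncard_latticePoints_CBP,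
      ConnectedBlocks.polytopeDim_CBP]
    omega
  · have h3 := ConnectedBlocks.two_mul_ncard_blocks_eq_iff hG
    rw [ConnectedBlocks.gammaStar, ConnectedBlocks.gammaVector_one, h1,
      ConnectedBlocks.hStar_zero hne, ConnectedBlocks.ncard_latticePoints_CBP,
      ConnectedBlocks.polytopeDim_CBP]
    refine ⟨by omega, ?_, ?_⟩ <;> split_ifs <;> omega
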